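/- Let $\lambda\in(0,1]$ and let $(\varepsilon_i)_{i\in\mathbb N}$ be a sequence of real numbers with $\varepsilon_i\to 0$ and $\sum_i\varepsilon_i^2=\infty$. Let $X=\{0,1\}^{\mathbb N}$ with the product measure $\mu=\bigotimes_i\mu_i$, where $$\mu_i(0)=\frac1{1+\lambda e^{\varepsilon_i}},\qquad \mu_i(1)=\frac{\lambda e^{\varepsilon_i}}{1+\lambda e^{\varepsilon_i}},$$ and let $\mathcal R$ be the tail equivalence relation on $X$: $x\sim y$ if and only if $x_i=y_i$ for all sufficiently large $i$. Put $\Lambda(x,y)=\sum_i(y_i-x_i)\log\lambda$ for $(x,y)\in\mathcal R$ (a finite sum). A Radon–Nikodym cocycle of $(\mathcal R,\mu)$ is a Borel map $\Delta:\mathcal R\to(0,\infty)$ for which there is a countable group $\Gamma$ of Borel bijections of $X$ whose orbits are exactly the $\mathcal R$-classes, such that for each $\gamma\in\Gamma$ the function $x\mapsto\Delta(x,\gamma x)$ is the Radon–Nikodym derivative $d(\mu\circ\gamma)/d\mu$, where $(\mu\circ\gamma)(A)=\mu(\gamma A)$. A Borel map $\alpha:\mathcal R\to\mathbb R$ is a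 cocycle if there is a $\mu$-conull set $A\subset X$ such that $\alpha(x,y)+\alpha(y,z)=\alpha(x,z)$ for all $x,y,z\in A$ with $x\sim y\sim z$. It is ergodic if, in addition, every Borel subset of $X\times\mathbb R$ that is invariant under the skew product relation $$(x,g)\sim(y,h)\iff (x,y)\in\mathcal R\ \text{ and }\ h=\alpha(x,y)+g$$ is null or conull for the product of $\mu$ and Lebesgue measure. Then a Radon–Nikodym cocycle $\Delta_{\mathcal R,\mu}$ of $(\mathcal R,\mu)$ exists, and for every choice of it the map $\log\Delta_{\mathcal R,\mu}-\Lambda$ is an ergodic $\mathbb R$-valued cocycle of $\mathcal R$. More generally, $\log\Delta_{\mathcal R,\mu}-t\Lambda$ is an ergodic $\mathbb R$-valued cocycle of $\mathcal R$ for every $t\in\mathbb R$. -/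

import Mathlib

open MeasureTheory Filter Topology

/-- The graph `{(x, y) | x ∼ y} ⊆ X × X` of an equivalence relation, with the Borel structure
induced from `X × X`. -/
abbrev RelGraph {X : Type*} (R : Setoid X) : Type _ := {p : X × X // R p.1 p.2}

/-- A relation `r` on a measure space is ergodic if every measurable `r`-invariant set is null or
conull. -/
def IsErgodicRel {X : Type*} [MeasurableSpace X] (r : X → X → Prop) (μ : Measure X) : Prop :=
  ∀ A : Set X, MeasurableSet A → (∀ x y, r x y → (x ∈ A ↔ y ∈ A)) → μ A = 0 ∨ μ Aᶜ = 0

/-- A Borel map `α : R → G` (the group `G` is written additively) is a cocycle of `R` if, on some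
`μ`-conull set, `α(x, y) + α(y, z) = α(x, z)` whenever `x ∼ y ∼ z`. -/
def IsRelCocycle {X G : Type*} [MeasurableSpace X] [MeasurableSpace G] [AddGroup G]
    (R : Setoid X) (μ : Measure X) (α : RelGraph R → G) : Prop :=
  Measurable α ∧
    ∃ A : Set X, μ Aᶜ = 0 ∧
      ∀ x ∈ A, ∀ y ∈ A, ∀ z ∈ A, ∀ (hxy : R x y) (hyz : R y z),
        α ⟨(x, y), hxy⟩ + α ⟨(y, z), hyz⟩ = α ⟨(x, z), R.trans hxy hyz⟩

/-- The skew product relation `R(α)` on `X × G`: `(x, g) ∼ (y, h)` if and only if `x ∼ y` and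
`h = α(x, y) + g`. -/
def skewProductRel {X G : Type*} [AddGroup G] (R : Setoid X) (α : RelGraph R → G)
    (p q : X × G) : Prop :=
  ∃ h : R p.1 q.1, q.2 = α ⟨(p.1, q.1), h⟩ + p.2

/-- A cocycle `α : R → G` is ergodic if the skew product relation `R(α)` is ergodic for
`μ × m`, where `m` is a Haar measure on `G`. -/
def IsErgodicCocycle {X G : Type*} [MeasurableSpace X] [MeasurableSpace G] [AddGroup G]
    (R : Setoid X) (μ : Measure X) (m : Measure G) (α : RelGraph R → G) : Prop :=
  IsRelCocycle R μ α ∧ IsErgodicRel (skewProductRel R α) (μ.prod m)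

/-- `Δ` is (a version of) the Radon-Nikodym cocycle of `(R, μ)`: it is Borel with positive values,
and for some countable group `Γ` of Borel bijections of `X` whose orbits are the `R`-classes,
`x ↦ Δ(x, γ x)` is, for each `γ ∈ Γ`, the Radon-Nikodym derivative with respect to `μ` of the
measure `μ ∘ γ : A ↦ μ (γ A)` (which is the image of `μ` under `γ⁻¹`). -/
def IsRadonNikodymCocycle {X : Type*} [MeasurableSpace X] (R : Setoid X) (μ : Measure X)
    (Δ : RelGraph R → ℝ) : Prop :=
  Measurable Δ ∧ (∀ p, 0 < Δ p) ∧
    ∃ Γ : Subgroup (Equiv.Perm X), Countable Γ ∧ (∀ γ ∈ Γ, Measurable γ) ∧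
      ∃ hΓ : ∀ x y, R x y ↔ ∃ γ ∈ Γ, γ x = y,
        ∀ (γ : Equiv.Perm X) (hγ : γ ∈ Γ),
          μ.map γ.symm =
            μ.withDensity
              (fun x => ENNReal.ofReal (Δ ⟨(x, γ x), (hΓ x (γ x)).2 ⟨γ, hγ, rfl⟩⟩))

/-- The tail equivalence relation on `A^ℕ`: two sequences are equivalent if they agree from some
index on. -/
def tailRel (A : Type*) : Setoid (ℕ → A) where
  r x y := ∃ N : ℕ, ∀ i ≥ N, x i = y i
  iseqv :=
    { refl := fun _ => ⟨0, fun _ _ => rfl⟩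
      symm := fun ⟨N, h⟩ => ⟨N, fun i hi => (h i hi).symm⟩
      trans := fun ⟨N, h⟩ ⟨M, k⟩ =>
        ⟨max N M, fun i hi =>
          (h i (le_trans (le_max_left N M) hi)).trans (k i (le_trans (le_max_right N M) hi))⟩ }

/-- The cocycle `Λ(x, y) = ∑ i, (y i - x i) * log lam` of the tail equivalence relation on
`{0,1}^ℕ`; only finitely many terms of the sum are nonzero. -/
noncomputable def tailLambda (lam : ℝ) (p : RelGraph (tailRel (Fin 2))) : ℝ :=
  ∑ᶠ i : ℕ, (((p.1.2 i : ℕ) : ℝ) - ((p.1.1 i : ℕ) : ℝ)) * Real.log lam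

/-!
Write `b i = log λ + ε i`. The measure of a cylinder is multiplied by `exp (∑ (y i - x i) * b i)` when
its word `x` is changed into `y`, so `exp (tailCocycle b)` is a Radon-Nikodym cocycle for the group
of translations by finitely supported sequences (`map_tailTranslate_symm`). Any other version agrees
with it at all pairs whose first point avoids a null set (`ae_log_eq_tailCocycle`). Hence
`log Δ - t Λ` is almost everywhere the cocycle `∑ (y i - x i) * a i` with `a i = c + ε i` and
`c = (1 - t) log λ`, and ergodicity of its skew product remains to be shown.

Let `B ⊆ X × ℝ` be invariant with sections `B_g`, let `p i = μ i {1}`, and let `u n g` be the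
proportion of `B_g` in the cylinder of `n` zeros. Splitting this cylinder according to its next
coordinate and using invariance gives
`u n g = (1 - p n) * u (n + 1) g + p n * u (n + 1) (g - a n)`.
Sequences with this property are called harmonic below: `u n`, evaluated along the random walk with
jumps `- a n` taken with probability `p n`, is a bounded martingale. Orthogonality of its differences
shows that the averages of `(u (n + 1) h - u (n + 1) (h - a n)) ^ 2` along the walk are summable in `n`
(`summable_walkAverage_sq_sub`). After convolution with a smooth kernel two things follow.
Since `a n → c`, the functions `u n` have period `c` (`harmonic_periodic`), so that `a n` may be
replaced by `ε n` in the summable series. If the derivative of `u 0`, itself the initial value of a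
harmonic sequence, did not vanish at a point, the `n`-th term of the series would be at least a
constant multiple of `ε n ^ 2`, against `∑ ε n ^ 2 = ∞` (`harmonic_deriv_eq_zero`). Removing the
convolution, all `u n` are almost everywhere equal to one constant `r` (`harmonic_ae_const_forall`).
By invariance `B_g` then occupies the proportion `r` of every cylinder, so `μ` restricted to `B_g` is
`r μ` for almost every `g`; evaluated at the complement of `B_g` this forces `r = 0` or `B_g` conull.
-/

/-! ### Averages along a random walk on the line -/

/-- The average of `f` over one step of a random walk which, from `h`, stays at `h` with weight
`1 - p` and jumps to `h - a` with weight `p`. -/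
def stepAverage (p a : ℝ) (f : ℝ → ℝ) (h : ℝ) : ℝ := (1 - p) * f h + p * f (h - a)

/-- The average of `f` over the position after `n` steps of a random walk started at the argument;
the `k`-th step has weight `p k` and jump `a k`. -/
def walkAverage (p a : ℕ → ℝ) : ℕ → (ℝ → ℝ) → ℝ → ℝ
  | 0, f => f
  | n + 1, f => walkAverage p a n (stepAverage (p n) (a n) f)

theorem walkAverage_succ (p a : ℕ → ℝ) (n : ℕ) (f : ℝ → ℝ) :
    walkAverage p a (n + 1) f = walkAverage p a n (stepAverage (p n) (a n) f) := rfl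

theorem walkAverage_mono {p a : ℕ → ℝ} (h0 : ∀ n, 0 ≤ p n) (h1 : ∀ n, p n ≤ 1) (n : ℕ) :
    ∀ {f f' : ℝ → ℝ}, (∀ h, f h ≤ f' h) → ∀ g, walkAverage p a n f g ≤ walkAverage p a n f' g := by
  induction n with
  | zero => exact fun hf g => hf g
  | succ n ih =>
    intro f f' hf g
    refine ih (fun h => ?_) g
    exact add_le_add (mul_le_mul_of_nonneg_left (hf _) (sub_nonneg.2 (h1 n)))
      (mul_le_mul_of_nonneg_left (hf _) (h0 n))

theorem walkAverage_const (p a : ℕ → ℝ) (n : ℕ) (c g : ℝ) :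
    walkAverage p a n (fun _ => c) g = c := by
  induction n with
  | zero => rfl
  | succ n ih =>
    have : stepAverage (p n) (a n) (fun _ => c) = fun _ => c := by
      ext h
      simp only [stepAverage]
      ring
    rw [walkAverage_succ, this, ih]

theorem walkAverage_add (p a : ℕ → ℝ) (n : ℕ) : ∀ (f f' : ℝ → ℝ) (g : ℝ),
    walkAverage p a n (fun h => f h + f' h) g = walkAverage p a n f g + walkAverage p a n f' g := by
  induction n with
  | zero => exact fun _ _ _ => rfl
  | succ n ih =>
    intro f f' g
    simp only [walkAverage_succ]
    rw [← ih]
    congr 1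
    ext h
    simp only [stepAverage]
    ring

theorem walkAverage_const_mul (p a : ℕ → ℝ) (n : ℕ) : ∀ (c : ℝ) (f : ℝ → ℝ) (g : ℝ),
    walkAverage p a n (fun h => c * f h) g = c * walkAverage p a n f g := by
  induction n with
  | zero => exact fun _ _ _ => rfl
  | succ n ih =>
    intro c f g
    simp only [walkAverage_succ]
    rw [← ih]
    congr 1
    ext h
    simp only [stepAverage]
    ring

/-! ### Harmonic sequences of functions -/

/-- The second moments of a harmonic sequence increase along the walk by the conditional variances
of its steps. -/
theorem walkAverage_sq_succ {p a : ℕ → ℝ} {u : ℕ → ℝ → ℝ}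
    (hu : ∀ n h, u n h = stepAverage (p n) (a n) (u (n + 1)) h) (n : ℕ) (g : ℝ) :
    walkAverage p a (n + 1) (fun h => u (n + 1) h ^ 2) g =
      walkAverage p a n (fun h => u n h ^ 2) g +
        p n * (1 - p n) * walkAverage p a n
          (fun h => (u (n + 1) h - u (n + 1) (h - a n)) ^ 2) g := by
  rw [walkAverage_succ, ← walkAverage_const_mul, ← walkAverage_add]
  congr 1
  ext h
  rw [hu n h]
  simp only [stepAverage]
  ring

theorem walkAverage_sq_nonneg {p a : ℕ → ℝ} (h0 : ∀ n, 0 ≤ p n) (h1 : ∀ n, p n ≤ 1) (n : ℕ)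
    (f : ℝ → ℝ) (g : ℝ) : 0 ≤ walkAverage p a n (fun h => f h ^ 2) g := by
  have := walkAverage_mono (a := a) h0 h1 n (f := fun _ => 0) (f' := fun h => f h ^ 2)
    (fun h => sq_nonneg _) g
  rwa [walkAverage_const] at this

theorem sq_le_walkAverage_sq {p a : ℕ → ℝ} (h0 : ∀ n, 0 ≤ p n) (h1 : ∀ n, p n ≤ 1)
    {u : ℕ → ℝ → ℝ} (hu : ∀ n h, u n h = stepAverage (p n) (a n) (u (n + 1)) h) (n : ℕ) (g : ℝ) :
    u 0 g ^ 2 ≤ walkAverage p a n (fun h => u n h ^ 2) g := by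
  induction n with
  | zero => exact le_rfl
  | succ n ih =>
    rw [walkAverage_sq_succ hu]
    have := mul_nonneg (mul_nonneg (h0 n) (sub_nonneg.2 (h1 n)))
      (walkAverage_sq_nonneg (a := a) h0 h1 n (fun h => u (n + 1) h - u (n + 1) (h - a n)) g)
    linarith

/-- The square variation of a bounded harmonic sequence is summable: orthogonality of martingale
differences. -/
theorem summable_walkAverage_sq_sub {p a : ℕ → ℝ} (h0 : ∀ n, 0 ≤ p n) (h1 : ∀ n, p n ≤ 1)
    {κ : ℝ} (hκ : 0 < κ) (hp : ∀ n, κ ≤ p n * (1 - p n))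
    {u : ℕ → ℝ → ℝ} (hu : ∀ n h, u n h = stepAverage (p n) (a n) (u (n + 1)) h)
    {M : ℝ} (hM : ∀ n h, |u n h| ≤ M) (g : ℝ) :
    Summable fun n => walkAverage p a n (fun h => (u (n + 1) h - u (n + 1) (h - a n)) ^ 2) g := by
  have hnn := fun n => walkAverage_sq_nonneg (a := a) h0 h1 n
    (fun h => u (n + 1) h - u (n + 1) (h - a n)) g
  refine summable_of_sum_range_le (c := M ^ 2 / κ) hnn fun N => ?_
  rw [le_div_iff₀ hκ]
  have key : ∀ N, (∑ n ∈ Finset.range N, walkAverage p a n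
      (fun h => (u (n + 1) h - u (n + 1) (h - a n)) ^ 2) g) * κ ≤
      walkAverage p a N (fun h => u N h ^ 2) g := by
    intro N
    induction N with
    | zero => simpa using walkAverage_sq_nonneg (a := a) h0 h1 0 (u 0) g
    | succ N ih =>
      rw [Finset.sum_range_succ, walkAverage_sq_succ hu, add_mul]
      have := mul_le_mul_of_nonneg_right (hp N) (hnn N)
      linarith
  refine (key N).trans ?_
  have := walkAverage_mono (a := a) h0 h1 N (f := fun h => u N h ^ 2) (f' := fun _ => M ^ 2)
    (fun h => sq_le_sq' (abs_le.1 (hM N h)).1 (abs_le.1 (hM N h)).2) g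
  rwa [walkAverage_const] at this

/-- A bounded, uniformly Lipschitz harmonic sequence for a walk whose jumps converge to `c` has
period `c`. The function `v n = u n - u n (· - c)` is controlled by the steps of the two bounded
martingales given by `u` and `v`. -/
theorem harmonic_periodic {p ε : ℕ → ℝ} {c : ℝ} (h0 : ∀ n, 0 ≤ p n) (h1 : ∀ n, p n ≤ 1)
    {κ : ℝ} (hκ : 0 < κ) (hp : ∀ n, κ ≤ p n * (1 - p n)) (hε : Tendsto ε atTop (𝓝 0))
    {u : ℕ → ℝ → ℝ} (hu : ∀ n h, u n h = stepAverage (p n) (c + ε n) (u (n + 1)) h)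
    {M L : ℝ} (hM : ∀ n h, |u n h| ≤ M) (hL : ∀ n h k, |u n h - u n k| ≤ L * |h - k|) (g : ℝ) :
    u 0 (g - c) = u 0 g := by
  set v : ℕ → ℝ → ℝ := fun n h => u n h - u n (h - c) with hv
  have hvu : ∀ n h, v n h = stepAverage (p n) (c + ε n) (v (n + 1)) h := by
    intro n h
    simp only [hv, stepAverage]
    rw [hu n h, hu n (h - c)]
    simp only [stepAverage]
    rw [sub_right_comm h c]
    ring
  have hvM : ∀ n h, |v n h| ≤ 2 * M := fun n h => by
    have := abs_sub (u n h) (u n (h - c))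
    have := hM n h
    have := hM n (h - c)
    simp only [hv]
    linarith
  have su := summable_walkAverage_sq_sub h0 h1 hκ hp hu hM g
  have sv := summable_walkAverage_sq_sub h0 h1 hκ hp hvu hvM g
  have lim := ((su.tendsto_atTop_zero.const_mul 3).add (sv.tendsto_atTop_zero.const_mul 3)).add
    ((hε.pow 2).const_mul (3 * L ^ 2))
  have hle := ge_of_tendsto' (b := v 0 g ^ 2) lim fun n => by
    refine (sq_le_walkAverage_sq h0 h1 hvu n g).trans ?_
    have := walkAverage_mono (a := fun n => c + ε n) h0 h1 n (f := fun h => v n h ^ 2)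
      (f' := fun h => (3 * (u (n + 1) h - u (n + 1) (h - (c + ε n))) ^ 2 +
        3 * (v (n + 1) h - v (n + 1) (h - (c + ε n))) ^ 2) + 3 * L ^ 2 * ε n ^ 2)
      (fun h => ?_) g
    · rw [walkAverage_add, walkAverage_add, walkAverage_const_mul, walkAverage_const_mul,
        walkAverage_const] at this
      exact this
    · set A := u (n + 1) h - u (n + 1) (h - (c + ε n)) with hA
      set C := v (n + 1) h - v (n + 1) (h - (c + ε n)) with hC
      set E := u (n + 1) (h - (c + ε n)) - u (n + 1) (h - c) with hE
      have e1 : v n h = A + E - p n * C := by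
        rw [hvu n h]
        simp only [stepAverage, hC, hA, hE, hv]
        ring
      have e2 : E ^ 2 ≤ L ^ 2 * ε n ^ 2 := by
        have := hL (n + 1) (h - (c + ε n)) (h - c)
        rw [show h - (c + ε n) - (h - c) = -ε n by ring, abs_neg] at this
        calc E ^ 2 = |E| ^ 2 := (sq_abs _).symm
          _ ≤ (L * |ε n|) ^ 2 := pow_le_pow_left₀ (abs_nonneg _) this 2
          _ = L ^ 2 * ε n ^ 2 := by rw [mul_pow, sq_abs]
      have e3 : (p n * C) ^ 2 ≤ C ^ 2 := by
        rw [mul_pow]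
        exact mul_le_of_le_one_left (sq_nonneg _) (pow_le_one₀ (h0 n) (h1 n))
      rw [e1]
      nlinarith [sq_nonneg (A - E), sq_nonneg (A + p n * C), sq_nonneg (E + p n * C)]
  have h2 : v 0 g ^ 2 = 0 := le_antisymm (by simpa using hle) (sq_nonneg _)
  have h3 : v 0 g = 0 := by simpa using h2
  simp only [hv] at h3
  linarith

/-- A harmonic sequence of functions with uniform bounds on the functions, their derivatives and
the Lipschitz constants of their derivatives is constant when the jumps of the walk converge to `c`
at a rate that is not square summable. By periodicity only the deviations `ε n` of the jumps from
`c` matter, and a nonzero derivative would make the square variation comparable to `∑ ε n ^ 2`. -/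
theorem harmonic_deriv_eq_zero {p ε : ℕ → ℝ} {c : ℝ} (h0 : ∀ n, 0 ≤ p n) (h1 : ∀ n, p n ≤ 1)
    {κ : ℝ} (hκ : 0 < κ) (hp : ∀ n, κ ≤ p n * (1 - p n)) (hε : Tendsto ε atTop (𝓝 0))
    (hε2 : ¬ Summable fun n => ε n ^ 2)
    {u w : ℕ → ℝ → ℝ} (hu : ∀ n h, u n h = stepAverage (p n) (c + ε n) (u (n + 1)) h)
    {M K L : ℝ} (hM : ∀ n h, |u n h| ≤ M) (hd : ∀ n h, HasDerivAt (u n) (w n h) h)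
    (hK : ∀ n h, |w n h| ≤ K) (hL : ∀ n h k, |w n h - w n k| ≤ L * |h - k|) (g : ℝ) :
    w 0 g = 0 := by
  have hper : ∀ n h, u n (h - c) = u n h := fun n h => by
    refine harmonic_periodic (u := fun m => u (n + m)) (p := fun m => p (n + m))
      (ε := fun m => ε (n + m)) (fun m => h0 _) (fun m => h1 _) hκ (fun m => hp _) ?_
      (fun m h => hu (n + m) h) (fun m h => hM _ h) (L := K) (fun m h k => ?_) h
    · exact hε.comp (tendsto_add_atTop_nat n |>.congr fun m => add_comm m n)
    · have := Convex.norm_image_sub_le_of_norm_hasDerivWithin_le (s := Set.univ) (C := K)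
        (fun x _ => (hd (n + m) x).hasDerivWithinAt) (fun x _ => hK _ x) convex_univ
        (Set.mem_univ k) (Set.mem_univ h)
      simpa [Real.norm_eq_abs] using this
  have hwu : ∀ n h, w n h = stepAverage (p n) (c + ε n) (w (n + 1)) h := fun n h => by
    have e : u n = fun h => (1 - p n) * u (n + 1) h + p n * u (n + 1) (h - (c + ε n)) :=
      funext fun h => hu n h
    have d2 := (((hd (n + 1) h).const_mul (1 - p n)).add
      (((hd (n + 1) (h - (c + ε n))).comp_sub_const h (c + ε n)).const_mul (p n)))
    have d1 := hd n h
    rw [e] at d1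
    exact d1.unique d2
  have hwper : ∀ n h, w n (h - c) = w n h := fun n h => by
    have d2 := (hd n (h - c)).comp_sub_const h c
    simp only [hper] at d2
    exact d2.unique (hd n h)
  have su := summable_walkAverage_sq_sub h0 h1 hκ hp hu hM g
  by_contra hne
  have hη : 0 < w 0 g ^ 2 := by positivity
  refine hε2 ?_
  have hpt : ∀ n h, ε n ^ 2 * w n h ^ 2 ≤
      2 * (u (n + 1) h - u (n + 1) (h - (c + ε n))) ^ 2 + 8 * L ^ 2 * ε n ^ 4 := by
    intro n h
    have hL0 : 0 ≤ L := by
      have := (abs_nonneg _).trans (hL 0 1 0)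
      simpa using this
    have e1 : |w n h - w (n + 1) h| ≤ L * |ε n| := by
      rw [hwu n h]
      simp only [stepAverage]
      rw [← sub_sub h c, sub_right_comm h c, hwper,
        show (1 - p n) * w (n + 1) h + p n * w (n + 1) (h - ε n) - w (n + 1) h
          = p n * (w (n + 1) (h - ε n) - w (n + 1) h) by ring, abs_mul, abs_of_nonneg (h0 n)]
      refine (mul_le_of_le_one_left (abs_nonneg _) (h1 n)).trans ((hL _ _ _).trans_eq ?_)
      simp
    have e2 : |u (n + 1) h - u (n + 1) (h - (c + ε n)) - ε n * w (n + 1) h| ≤ L * |ε n| ^ 2 := by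
      rw [← sub_sub h c, sub_right_comm h c, hper]
      -- the function `y ↦ u y - y * u' h` has derivative at most `L |ε n|` between `h - ε n` and `h`
      have := Convex.norm_image_sub_le_of_norm_hasDerivWithin_le (s := Metric.closedBall h |ε n|)
        (C := L * |ε n|) (f := fun y => u (n + 1) y - y * w (n + 1) h)
        (f' := fun y => w (n + 1) y - 1 * w (n + 1) h)
        (fun x _ => ((hd (n + 1) x).sub ((hasDerivAt_id x).mul_const _)).hasDerivWithinAt)
        (fun x hx => by
          rw [one_mul, Real.norm_eq_abs]
          refine (hL _ _ _).trans (mul_le_mul_of_nonneg_left ?_ hL0)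
          rwa [Metric.mem_closedBall, Real.dist_eq] at hx)
        (convex_closedBall _ _) (x := h - ε n) (y := h)
        (by simp) (by simp)
      rw [Real.norm_eq_abs, Real.norm_eq_abs, sub_sub_cancel] at this
      rw [show u (n + 1) h - u (n + 1) (h - ε n) - ε n * w (n + 1) h
        = u (n + 1) h - h * w (n + 1) h - (u (n + 1) (h - ε n) - (h - ε n) * w (n + 1) h) by ring]
      exact this.trans_eq (by ring)
    set A := u (n + 1) h - u (n + 1) (h - (c + ε n))
    have e3 : |ε n * w n h - A| ≤ 2 * L * |ε n| ^ 2 := by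
      rw [show ε n * w n h - A = ε n * (w n h - w (n + 1) h) - (A - ε n * w (n + 1) h) by ring]
      refine (abs_sub _ _).trans ?_
      rw [abs_mul]
      have := mul_le_mul_of_nonneg_left e1 (abs_nonneg (ε n))
      nlinarith
    have e4 : (ε n * w n h - A) ^ 2 ≤ 4 * L ^ 2 * ε n ^ 4 := by
      calc (ε n * w n h - A) ^ 2 = |ε n * w n h - A| ^ 2 := (sq_abs _).symm
        _ ≤ (2 * L * |ε n| ^ 2) ^ 2 := pow_le_pow_left₀ (abs_nonneg _) e3 2
        _ = 4 * L ^ 2 * ε n ^ 4 := by rw [sq_abs]; ring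
    nlinarith [sq_nonneg (ε n * w n h - 2 * A)]
  have hT : ∀ n, ε n ^ 2 * w 0 g ^ 2 ≤
      2 * walkAverage p (fun n => c + ε n) n
        (fun h => (u (n + 1) h - u (n + 1) (h - (c + ε n))) ^ 2) g + 8 * L ^ 2 * ε n ^ 4 := by
    intro n
    refine (mul_le_mul_of_nonneg_left (sq_le_walkAverage_sq h0 h1 hwu n g) (sq_nonneg _)).trans ?_
    have := walkAverage_mono (a := fun n => c + ε n) h0 h1 n (hpt n) g
    rwa [walkAverage_add, walkAverage_const_mul, walkAverage_const_mul, walkAverage_const] at this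
  have hsmall : ∀ᶠ n in atTop, 8 * L ^ 2 * ε n ^ 2 ≤ w 0 g ^ 2 / 2 := by
    have := (hε.pow 2).const_mul (8 * L ^ 2)
    refine this.eventually_le_const ?_
    simp only [ne_eq, OfNat.ofNat_ne_zero, not_false_eq_true, zero_pow, mul_zero]
    positivity
  refine Summable.of_norm_bounded_eventually_nat (su.mul_left (4 / w 0 g ^ 2)) ?_
  filter_upwards [hsmall] with n hn
  rw [Real.norm_eq_abs, abs_of_nonneg (sq_nonneg _), div_mul_eq_mul_div, le_div_iff₀ hη]
  nlinarith [hT n, mul_le_mul_of_nonneg_right hn (sq_nonneg (ε n))]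

/-! ### Bounded measurable harmonic sequences -/

theorem integrable_mul_comp_sub_left {f u : ℝ → ℝ} (hf : Integrable f) (hu : Measurable u) {M : ℝ}
    (hM : ∀ h, |u h| ≤ M) (x : ℝ) : Integrable fun t => f t * u (x - t) := by
  refine hf.mul_bdd (c := M) (hu.comp (measurable_const.sub measurable_id)).aestronglyMeasurable ?_
  exact Eventually.of_forall fun t => hM _

theorem abs_integral_mul_comp_sub_left_le {f u : ℝ → ℝ} (hf : Integrable f) {M : ℝ}
    (hM : ∀ h, |u h| ≤ M) (x : ℝ) : |∫ t, f t * u (x - t)| ≤ (∫ t, |f t|) * M := by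
  rw [← integral_mul_const, ← Real.norm_eq_abs]
  refine norm_integral_le_of_norm_le (hf.abs.mul_const M) (Eventually.of_forall fun t => ?_)
  rw [Real.norm_eq_abs, abs_mul]
  exact mul_le_mul_of_nonneg_left (hM _) (abs_nonneg _)

theorem locallyIntegrable_of_abs_le {u : ℝ → ℝ} (hu : Measurable u) {M : ℝ}
    (hM : ∀ h, |u h| ≤ M) : LocallyIntegrable u :=
  LocallyIntegrable.mono (locallyIntegrable_const M) hu.aestronglyMeasurable
    (Eventually.of_forall fun h => (hM h).trans (le_abs_self M))

theorem hasDerivAt_integral_mul_comp_sub_left {f u : ℝ → ℝ} (hf : HasCompactSupport f)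
    (hf' : ContDiff ℝ 1 f) (hu : Measurable u) {M : ℝ} (hM : ∀ h, |u h| ≤ M) (x : ℝ) :
    HasDerivAt (fun x => ∫ t, f t * u (x - t)) (∫ t, deriv f t * u (x - t)) x :=
  hf.hasDerivAt_convolution_left (ContinuousLinearMap.lsmul ℝ ℝ) hf'
    (locallyIntegrable_of_abs_le hu hM) x

/-- A convolution of a bounded measurable harmonic sequence with a smooth kernel is constant. -/
theorem harmonic_integral_mul_eq {p ε : ℕ → ℝ} {c : ℝ} (h0 : ∀ n, 0 ≤ p n) (h1 : ∀ n, p n ≤ 1)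
    {κ : ℝ} (hκ : 0 < κ) (hp : ∀ n, κ ≤ p n * (1 - p n)) (hε : Tendsto ε atTop (𝓝 0))
    (hε2 : ¬ Summable fun n => ε n ^ 2)
    {u : ℕ → ℝ → ℝ} (hu : ∀ n h, u n h = stepAverage (p n) (c + ε n) (u (n + 1)) h)
    (hm : ∀ n, Measurable (u n)) {M : ℝ} (hM : ∀ n h, |u n h| ≤ M)
    {f : ℝ → ℝ} (hf : HasCompactSupport f) (hf' : ContDiff ℝ 2 f) (x y : ℝ) :
    ∫ t, f t * u 0 (x - t) = ∫ t, f t * u 0 (y - t) := by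
  have hf1 : ContDiff ℝ 1 f := hf'.of_le one_le_two
  have hdf : ContDiff ℝ 1 (deriv f) := ((contDiff_succ_iff_deriv (n := 1)).1 hf').2.2
  have if0 : Integrable f := hf'.continuous.integrable_of_hasCompactSupport hf
  have if1 : Integrable (deriv f) := hdf.continuous.integrable_of_hasCompactSupport hf.deriv
  have if2 : Integrable (deriv (deriv f)) :=
    (hdf.continuous_deriv le_rfl).integrable_of_hasCompactSupport hf.deriv.deriv
  have hd := fun n x => hasDerivAt_integral_mul_comp_sub_left hf hf1 (hm n) (hM n) x
  have hd' := fun n x => hasDerivAt_integral_mul_comp_sub_left hf.deriv hdf (hm n) (hM n) x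
  have hz := harmonic_deriv_eq_zero (c := c) h0 h1 hκ hp hε hε2
    (u := fun n x => ∫ t, f t * u n (x - t)) (w := fun n x => ∫ t, deriv f t * u n (x - t))
    (fun n h => ?_) (fun n h => abs_integral_mul_comp_sub_left_le if0 (hM n) h) hd
    (fun n h => abs_integral_mul_comp_sub_left_le if1 (hM n) h)
    (L := (∫ t, |deriv (deriv f) t|) * M) (fun n h k => ?_)
  · refine is_const_of_deriv_eq_zero (fun x => (hd 0 x).differentiableAt) (fun x => ?_) x y
    rw [(hd 0 x).deriv, hz]
  · simp only [stepAverage]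
    rw [← integral_const_mul, ← integral_const_mul, ← integral_add]
    · refine integral_congr_ae (Eventually.of_forall fun t => ?_)
      simp only [hu n, stepAverage, sub_right_comm h t]
      ring
    · exact (integrable_mul_comp_sub_left if0 (hm _) (hM _) _).const_mul _
    · exact (integrable_mul_comp_sub_left if0 (hm _) (hM _) _).const_mul _
  · have := Convex.norm_image_sub_le_of_norm_hasDerivWithin_le (s := Set.univ)
      (fun x _ => (hd' n x).hasDerivWithinAt)
      (fun x _ => abs_integral_mul_comp_sub_left_le if2 (hM n) x) convex_univ
      (Set.mem_univ k) (Set.mem_univ h)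
    simpa [Real.norm_eq_abs] using this

/-- A bounded measurable harmonic sequence is constant almost everywhere, as the limit of its
convolutions with an approximate identity. -/
theorem harmonic_ae_const {p ε : ℕ → ℝ} {c : ℝ} (h0 : ∀ n, 0 ≤ p n) (h1 : ∀ n, p n ≤ 1)
    {κ : ℝ} (hκ : 0 < κ) (hp : ∀ n, κ ≤ p n * (1 - p n)) (hε : Tendsto ε atTop (𝓝 0))
    (hε2 : ¬ Summable fun n => ε n ^ 2)
    {u : ℕ → ℝ → ℝ} (hu : ∀ n h, u n h = stepAverage (p n) (c + ε n) (u (n + 1)) h)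
    (hm : ∀ n, Measurable (u n)) {M : ℝ} (hM : ∀ n h, |u n h| ≤ M) :
    ∃ r : ℝ, ∀ᵐ h, u 0 h = r := by
  let φ : ℕ → ContDiffBump (0 : ℝ) := fun k =>
    ⟨1 / (k + 1), 2 * (1 / (k + 1)), by positivity, by
      have : (0 : ℝ) < 1 / (k + 1) := by positivity
      linarith⟩
  have hφ : Tendsto (fun k => (φ k).rOut) atTop (𝓝 0) := by
    have := (tendsto_one_div_add_atTop_nhds_zero_nat (𝕜 := ℝ)).const_mul 2
    rwa [mul_zero] at this
  have hae := ContDiffBump.ae_convolution_tendsto_right_of_locallyIntegrable (μ := volume) hφ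
    (K := 2) (Eventually.of_forall fun k => le_rfl) (locallyIntegrable_of_abs_le (hm 0) (hM 0))
  obtain ⟨x₀, hx₀⟩ := hae.exists
  refine ⟨u 0 x₀, ?_⟩
  filter_upwards [hae] with h hh
  refine tendsto_nhds_unique hh (hx₀.congr fun k => ?_)
  exact harmonic_integral_mul_eq h0 h1 hκ hp hε hε2 hu hm hM
    ((φ k).hasCompactSupport_normed) ((φ k).contDiff_normed (n := 2)) x₀ h

/-- The constants of the members of a harmonic sequence agree. -/
theorem harmonic_ae_const_forall {p ε : ℕ → ℝ} {c : ℝ} (h0 : ∀ n, 0 ≤ p n) (h1 : ∀ n, p n ≤ 1)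
    {κ : ℝ} (hκ : 0 < κ) (hp : ∀ n, κ ≤ p n * (1 - p n)) (hε : Tendsto ε atTop (𝓝 0))
    (hε2 : ¬ Summable fun n => ε n ^ 2)
    {u : ℕ → ℝ → ℝ} (hu : ∀ n h, u n h = stepAverage (p n) (c + ε n) (u (n + 1)) h)
    (hm : ∀ n, Measurable (u n)) {M : ℝ} (hM : ∀ n h, |u n h| ≤ M) :
    ∃ r : ℝ, ∀ n, ∀ᵐ h, u n h = r := by
  have hex : ∀ n, ∃ r : ℝ, ∀ᵐ h, u n h = r := fun n => by
    refine harmonic_ae_const (u := fun m => u (n + m)) (p := fun m => p (n + m))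
      (ε := fun m => ε (n + m)) (fun m => h0 _) (fun m => h1 _) hκ (fun m => hp _) ?_ ?_
      (fun m h => hu (n + m) h) (fun m => hm _) (fun m h => hM _ h)
    · exact hε.comp (tendsto_add_atTop_nat n |>.congr fun m => add_comm m n)
    · intro hs
      refine hε2 ((summable_nat_add_iff n).1 (hs.congr fun m => ?_))
      rw [add_comm]
  choose r hr using hex
  have hstep : ∀ n, r n = r (n + 1) := fun n => by
    have hsub : ∀ᵐ h : ℝ, u (n + 1) (h - (c + ε n)) = r (n + 1) :=
      (measurePreserving_sub_right volume (c + ε n)).quasiMeasurePreserving.ae (hr (n + 1))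
    obtain ⟨h, e1, e2, e3⟩ := ((hr n).and ((hr (n + 1)).and hsub)).exists
    rw [hu n h, stepAverage, e2, e3] at e1
    rw [← e1]
    ring
  have hall : ∀ n, r n = r 0 := fun n => by
    induction n with
    | zero => rfl
    | succ n ih => rw [← hstep, ih]
  exact ⟨r 0, fun n => (hr n).mono fun h hh => hh.trans (hall n)⟩

/-! ### Cocycles of the tail equivalence relation -/

/-- The cocycle `(x, y) ↦ ∑ i, (y i - x i) * a i` of the tail equivalence relation on `{0,1}^ℕ`. -/
noncomputable def tailCocycle (a : ℕ → ℝ) (p : RelGraph (tailRel (Fin 2))) : ℝ :=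
  ∑ᶠ i : ℕ, (((p.1.2 i : ℕ) : ℝ) - ((p.1.1 i : ℕ) : ℝ)) * a i

theorem tailCocycle_eq_sum (a : ℕ → ℝ) (p : RelGraph (tailRel (Fin 2))) {n : ℕ}
    (hn : ∀ i ≥ n, p.1.1 i = p.1.2 i) :
    tailCocycle a p =
      ∑ i ∈ Finset.range n, (((p.1.2 i : ℕ) : ℝ) - ((p.1.1 i : ℕ) : ℝ)) * a i := by
  refine finsum_eq_sum_of_support_subset _ fun i hi => ?_
  by_contra h
  refine hi ?_
  simp only [Finset.coe_range, Set.mem_Iio, not_lt] at h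
  simp [hn i h]

theorem tailCocycle_add (a : ℕ → ℝ) {x y z : ℕ → Fin 2} (hxy : tailRel (Fin 2) x y)
    (hyz : tailRel (Fin 2) y z) :
    tailCocycle a ⟨(x, y), hxy⟩ + tailCocycle a ⟨(y, z), hyz⟩ =
      tailCocycle a ⟨(x, z), (tailRel (Fin 2)).trans hxy hyz⟩ := by
  obtain ⟨N, hN⟩ := id hxy
  obtain ⟨K, hK⟩ := id hyz
  have h1 : ∀ i ≥ max N K, x i = y i := fun i hi => hN i ((le_max_left _ _).trans hi)
  have h2 : ∀ i ≥ max N K, y i = z i := fun i hi => hK i ((le_max_right _ _).trans hi)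
  rw [tailCocycle_eq_sum a ⟨(x, y), hxy⟩ h1, tailCocycle_eq_sum a ⟨(y, z), hyz⟩ h2,
    tailCocycle_eq_sum a ⟨(x, z), (tailRel (Fin 2)).trans hxy hyz⟩
      (fun i hi => (h1 i hi).trans (h2 i hi)), ← Finset.sum_add_distrib]
  refine Finset.sum_congr rfl fun i _ => ?_
  ring

theorem tailCocycle_sub_mul_tailLambda (b : ℕ → ℝ) (lam t : ℝ) (p : RelGraph (tailRel (Fin 2))) :
    tailCocycle b p - t * tailLambda lam p = tailCocycle (fun i => b i - t * Real.log lam) p := by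
  obtain ⟨N, hN⟩ := p.2
  have h : tailLambda lam p = tailCocycle (fun _ => Real.log lam) p := rfl
  rw [h, tailCocycle_eq_sum _ p hN, tailCocycle_eq_sum _ p hN, tailCocycle_eq_sum _ p hN,
    Finset.mul_sum, ← Finset.sum_sub_distrib]
  refine Finset.sum_congr rfl fun i _ => ?_
  ring

theorem measurable_tailCocycle (a : ℕ → ℝ) : Measurable (tailCocycle a) := by
  have hc : Measurable fun k : Fin 2 => ((k : ℕ) : ℝ) := measurable_of_countable _
  refine measurable_of_tendsto_metrizable (f := fun (n : ℕ) (p : RelGraph (tailRel (Fin 2))) =>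
    ∑ i ∈ Finset.range n, (((p.1.2 i : ℕ) : ℝ) - ((p.1.1 i : ℕ) : ℝ)) * a i) (fun n => ?_) ?_
  · refine Finset.measurable_sum _ fun i _ => ?_
    have m1 : Measurable fun p : RelGraph (tailRel (Fin 2)) => p.1.1 i :=
      (measurable_pi_apply i).comp (measurable_fst.comp measurable_subtype_coe)
    have m2 : Measurable fun p : RelGraph (tailRel (Fin 2)) => p.1.2 i :=
      (measurable_pi_apply i).comp (measurable_snd.comp measurable_subtype_coe)
    exact ((hc.comp m2).sub (hc.comp m1)).mul_const _
  · rw [tendsto_pi_nhds]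
    intro p
    obtain ⟨N, hN⟩ := p.2
    refine tendsto_const_nhds.congr' ?_
    filter_upwards [eventually_ge_atTop N] with n hn
    exact tailCocycle_eq_sum a p fun i hi => hN i (hn.trans hi)

/-! ### Translations by finitely supported sequences -/

/-- Translation by a finitely supported sequence: it flips finitely many coordinates. -/
def tailTranslate (d : ℕ →₀ Fin 2) : Equiv.Perm (ℕ → Fin 2) := Equiv.addRight (d : ℕ → Fin 2)

theorem tailTranslate_apply (d : ℕ →₀ Fin 2) (x : ℕ → Fin 2) : tailTranslate d x = x + d := rfl

theorem tailTranslate_symm (d : ℕ →₀ Fin 2) : (tailTranslate d).symm = tailTranslate (-d) := by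
  ext x
  simp [tailTranslate]

theorem measurable_tailTranslate (d : ℕ →₀ Fin 2) : Measurable (tailTranslate d) := by
  refine measurable_pi_iff.2 fun i => ?_
  exact (measurable_of_countable fun k : Fin 2 => k + d i).comp (measurable_pi_apply i)

theorem exists_forall_ge_eq_zero (d : ℕ →₀ Fin 2) : ∃ n, ∀ i ≥ n, d i = 0 := by
  obtain ⟨n, hn⟩ := d.support.exists_nat_subset_range
  refine ⟨n, fun i hi => ?_⟩
  by_contra h
  exact absurd (Finset.mem_range.1 (hn (Finsupp.mem_support_iff.2 h))) (not_lt.2 hi)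

theorem tailRel_tailTranslate (d : ℕ →₀ Fin 2) (x : ℕ → Fin 2) :
    tailRel (Fin 2) x (tailTranslate d x) := by
  obtain ⟨n, hn⟩ := exists_forall_ge_eq_zero d
  exact ⟨n, fun i hi => by simp [tailTranslate_apply, hn i hi]⟩

theorem exists_tailTranslate_eq {x y : ℕ → Fin 2} (h : tailRel (Fin 2) x y) :
    ∃ d : ℕ →₀ Fin 2, tailTranslate d x = y := by
  obtain ⟨n, hn⟩ := h
  refine ⟨Finsupp.onFinset (Finset.range n) (fun i => y i - x i) fun i hi => ?_, ?_⟩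
  · by_contra hc
    rw [Finset.mem_range, not_lt] at hc
    exact hi (by rw [hn i hc, sub_self])
  · ext i : 1
    simp [tailTranslate_apply]

/-- The group of translations by finitely supported sequences. Its orbits are the classes of the
tail equivalence relation. -/
def tailTranslateGroup : Subgroup (Equiv.Perm (ℕ → Fin 2)) where
  carrier := Set.range tailTranslate
  one_mem' := ⟨0, by ext x; simp [tailTranslate_apply]⟩
  mul_mem' := by
    rintro _ _ ⟨d, rfl⟩ ⟨e, rfl⟩
    refine ⟨e + d, ?_⟩
    ext x
    simp [tailTranslate_apply, add_assoc]
  inv_mem' := by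
    rintro _ ⟨d, rfl⟩
    exact ⟨-d, (tailTranslate_symm d).symm⟩

theorem countable_tailTranslateGroup : Countable tailTranslateGroup :=
  (Set.countable_range tailTranslate).to_subtype

/-! ### Cylinders and the Radon-Nikodym derivatives of translations -/

theorem measurableSet_cylinder_fin_two (w : ℕ → Fin 2) (n : ℕ) :
    MeasurableSet (PiNat.cylinder w n) := by
  rw [PiNat.cylinder_eq_pi]
  exact MeasurableSet.pi (Finset.countable_toSet _) fun i _ => MeasurableSet.singleton _

/-- Measures on `{0,1}^ℕ` are determined by their values on all sufficiently long cylinders. -/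
theorem measure_ext_of_cylinder {ν₁ ν₂ : Measure (ℕ → Fin 2)} [IsFiniteMeasure ν₂] (N : ℕ)
    (h : ∀ n ≥ N, ∀ w, ν₁ (PiNat.cylinder w n) = ν₂ (PiNat.cylinder w n)) : ν₁ = ν₂ := by
  have key : ∀ n ≥ N, ν₁.map (Finset.range n).restrict = ν₂.map (Finset.range n).restrict := by
    intro n hn
    refine Measure.ext_of_singleton fun v => ?_
    rw [Measure.map_apply (by fun_prop) (MeasurableSet.singleton _),
      Measure.map_apply (by fun_prop) (MeasurableSet.singleton _)]
    have e : (Finset.range n).restrict (π := fun _ : ℕ => Fin 2) ⁻¹' {v} =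
        PiNat.cylinder (fun i => if hi : i ∈ Finset.range n then v ⟨i, hi⟩ else 0) n := by
      ext x
      rw [PiNat.mem_cylinder_iff, Set.mem_preimage, Set.mem_singleton_iff, funext_iff]
      constructor
      · intro hx i hi
        have hi' : i ∈ Finset.range n := Finset.mem_range.2 hi
        rw [dif_pos hi']
        exact hx ⟨i, hi'⟩
      · rintro hx ⟨i, hi⟩
        have := hx i (Finset.mem_range.1 hi)
        rwa [dif_pos hi] at this
    rw [e, h n hn]
  refine IsProjectiveLimit.unique (P := fun I => ν₂.map I.restrict) (fun I => ?_) fun I => rfl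
  obtain ⟨n, hn⟩ := I.exists_nat_subset_range
  have hI : I ⊆ Finset.range (max n N) :=
    hn.trans (Finset.range_subset_range.2 (le_max_left _ _))
  have hr := key (max n N) (le_max_right _ _)
  have hcomp : I.restrict (π := fun _ : ℕ => Fin 2) =
    Finset.restrict₂ hI ∘ (Finset.range (max n N)).restrict := rfl
  change ν₁.map I.restrict = ν₂.map I.restrict
  rw [hcomp, ← Measure.map_map (by fun_prop) (by fun_prop), hr,
    Measure.map_map (by fun_prop) (by fun_prop)]

theorem measure_singleton_eq_exp_mul {m : Measure (Fin 2)} {b : ℝ}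
    (hb : m {1} = ENNReal.ofReal (Real.exp b) * m {0}) (x y : Fin 2) :
    m {y} = ENNReal.ofReal (Real.exp ((((y : ℕ) : ℝ) - ((x : ℕ) : ℝ)) * b)) * m {x} := by
  fin_cases x <;> fin_cases y
  · simp
  · simpa using hb
  · simp only [Fin.zero_eta, Fin.mk_one, Fin.isValue, hb]
    rw [← mul_assoc, ← ENNReal.ofReal_mul (Real.exp_nonneg _), ← Real.exp_add]
    simp
  · simp

theorem infinitePi_cylinder_eq_exp_mul {μ : ℕ → Measure (Fin 2)} [∀ i, IsProbabilityMeasure (μ i)]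
    {b : ℕ → ℝ} (hb : ∀ i, μ i {1} = ENNReal.ofReal (Real.exp (b i)) * μ i {0})
    (x y : ℕ → Fin 2) (n : ℕ) :
    Measure.infinitePi μ (PiNat.cylinder y n) =
      ENNReal.ofReal (Real.exp (∑ i ∈ Finset.range n,
        (((y i : ℕ) : ℝ) - ((x i : ℕ) : ℝ)) * b i)) *
        Measure.infinitePi μ (PiNat.cylinder x n) := by
  rw [PiNat.cylinder_eq_pi, PiNat.cylinder_eq_pi,
    Measure.infinitePi_pi _ fun i _ => MeasurableSet.singleton _,
    Measure.infinitePi_pi _ fun i _ => MeasurableSet.singleton _, Real.exp_sum,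
    ENNReal.ofReal_prod_of_nonneg fun i _ => Real.exp_nonneg _, ← Finset.prod_mul_distrib]
  exact Finset.prod_congr rfl fun i _ => measure_singleton_eq_exp_mul (hb i) _ _

/-- The Radon-Nikodym derivative of a translation: on long cylinders it is constant, equal to the
ratio of the measures of the cylinder and its image. -/
theorem map_tailTranslate_symm {μ : ℕ → Measure (Fin 2)} [∀ i, IsProbabilityMeasure (μ i)]
    {b : ℕ → ℝ} (hb : ∀ i, μ i {1} = ENNReal.ofReal (Real.exp (b i)) * μ i {0})
    (d : ℕ →₀ Fin 2) :
    (Measure.infinitePi μ).map (tailTranslate d).symm =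
      (Measure.infinitePi μ).withDensity fun x => ENNReal.ofReal
        (Real.exp (tailCocycle b ⟨(x, tailTranslate d x), tailRel_tailTranslate d x⟩)) := by
  have hms : Measurable (tailTranslate d).symm := by
    rw [tailTranslate_symm]
    exact measurable_tailTranslate _
  have : IsProbabilityMeasure ((Measure.infinitePi μ).map (tailTranslate d).symm) :=
    Measure.isProbabilityMeasure_map hms.aemeasurable
  obtain ⟨N, hN⟩ := exists_forall_ge_eq_zero d
  refine (measure_ext_of_cylinder N fun n hn w => ?_).symm
  have hpre : (tailTranslate d).symm ⁻¹' PiNat.cylinder w n =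
      PiNat.cylinder (tailTranslate d w) n := by
    ext x
    simp only [tailTranslate_symm, Set.mem_preimage, PiNat.mem_cylinder_iff, tailTranslate_apply,
      Pi.add_apply, Finsupp.coe_neg, Pi.sub_apply, ← sub_eq_add_neg, sub_eq_iff_eq_add]
  rw [Measure.map_apply hms (measurableSet_cylinder_fin_two _ _), hpre,
    withDensity_apply _ (measurableSet_cylinder_fin_two _ _),
    infinitePi_cylinder_eq_exp_mul hb w]
  rw [setLIntegral_congr_fun (measurableSet_cylinder_fin_two _ _) (g := fun _ => _),
    setLIntegral_const]
  intro x hx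
  rw [PiNat.mem_cylinder_iff] at hx
  dsimp only
  rw [tailCocycle_eq_sum b _ (n := n)
    (fun i hi => by simp [tailTranslate_apply, hN i (hn.trans hi)])]
  congr 2
  refine Finset.sum_congr rfl fun i hi => ?_
  simp only [tailTranslate_apply, Pi.add_apply, hx i (Finset.mem_range.1 hi)]

theorem measurable_tailRelGraph_mk {f : (ℕ → Fin 2) → ℕ → Fin 2} (hf : Measurable f)
    (h : ∀ x, tailRel (Fin 2) x (f x)) :
    Measurable fun x => (⟨(x, f x), h x⟩ : RelGraph (tailRel (Fin 2))) :=
  (measurable_id.prodMk hf).subtype_mk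

theorem isRadonNikodymCocycle_exp_tailCocycle {μ : ℕ → Measure (Fin 2)}
    [∀ i, IsProbabilityMeasure (μ i)] {b : ℕ → ℝ}
    (hb : ∀ i, μ i {1} = ENNReal.ofReal (Real.exp (b i)) * μ i {0}) :
    IsRadonNikodymCocycle (tailRel (Fin 2)) (Measure.infinitePi μ)
      fun p => Real.exp (tailCocycle b p) := by
  refine ⟨Real.measurable_exp.comp (measurable_tailCocycle b), fun p => Real.exp_pos _,
    tailTranslateGroup, countable_tailTranslateGroup, ?_, fun x y => ⟨fun h => ?_, ?_⟩, ?_⟩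
  · rintro _ ⟨d, rfl⟩
    exact measurable_tailTranslate d
  · obtain ⟨d, hd⟩ := exists_tailTranslate_eq h
    exact ⟨_, ⟨d, rfl⟩, hd⟩
  · rintro ⟨_, ⟨d, rfl⟩, rfl⟩
    exact tailRel_tailTranslate d x
  · rintro _ ⟨d, rfl⟩
    exact map_tailTranslate_symm hb d

/-- The Radon-Nikodym cocycle is unique up to a null set of first coordinates: any countable group
that generates the relation is, piece by piece, made of translations by finitely supported
sequences. -/
theorem ae_log_eq_tailCocycle {μ : ℕ → Measure (Fin 2)} [∀ i, IsProbabilityMeasure (μ i)]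
    {b : ℕ → ℝ} (hb : ∀ i, μ i {1} = ENNReal.ofReal (Real.exp (b i)) * μ i {0})
    {Δ : RelGraph (tailRel (Fin 2)) → ℝ}
    (h : IsRadonNikodymCocycle (tailRel (Fin 2)) (Measure.infinitePi μ) Δ) :
    ∀ᵐ x ∂Measure.infinitePi μ, ∀ y, ∀ hxy : tailRel (Fin 2) x y,
      Real.log (Δ ⟨(x, y), hxy⟩) = tailCocycle b ⟨(x, y), hxy⟩ := by
  obtain ⟨hΔ, hpos, Γ, hcount, hmeas, hΓ, hRN⟩ := h
  have key : ∀ (γ : Γ) (d : ℕ →₀ Fin 2), ∀ᵐ x ∂Measure.infinitePi μ,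
      γ.1 x = tailTranslate d x → ∀ hxy : tailRel (Fin 2) x (γ.1 x),
        Real.log (Δ ⟨(x, γ.1 x), hxy⟩) = tailCocycle b ⟨(x, γ.1 x), hxy⟩ := by
    rintro ⟨γ, hγ⟩ d
    have hS : MeasurableSet {x | γ x = tailTranslate d x} :=
      measurableSet_eq_fun (hmeas γ hγ) (measurable_tailTranslate d)
    have mγ : Measurable γ.symm := hmeas γ⁻¹ (Γ.inv_mem hγ)
    have md : Measurable (tailTranslate d).symm := by
      rw [tailTranslate_symm]
      exact measurable_tailTranslate _
    have hmaps : ((Measure.infinitePi μ).map γ.symm).restrict {x | γ x = tailTranslate d x} =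
        ((Measure.infinitePi μ).map (tailTranslate d).symm).restrict
          {x | γ x = tailTranslate d x} := by
      ext A hA
      rw [Measure.restrict_apply hA, Measure.restrict_apply hA,
        Measure.map_apply mγ (hA.inter hS), Measure.map_apply md (hA.inter hS)]
      congr 1
      ext y
      simp only [Set.mem_preimage, Set.mem_inter_iff, Set.mem_ofPred_eq, Equiv.apply_symm_apply]
      constructor
      · rintro ⟨h1, h2⟩
        have e : (tailTranslate d).symm y = γ.symm y := (Equiv.symm_apply_eq _).2 h2
        rw [e, Equiv.apply_symm_apply]
        exact ⟨h1, rfl⟩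
      · rintro ⟨h1, h2⟩
        have e : γ.symm y = (tailTranslate d).symm y := (Equiv.symm_apply_eq _).2 h2.symm
        rw [e]
        refine ⟨h1, ?_⟩
        rw [Equiv.apply_symm_apply]
    have m1 : Measurable fun x => ENNReal.ofReal
        (Δ ⟨(x, γ x), (hΓ x (γ x)).2 ⟨γ, hγ, rfl⟩⟩) :=
      ENNReal.measurable_ofReal.comp (hΔ.comp (measurable_tailRelGraph_mk (hmeas γ hγ) _))
    have m2 : Measurable fun x => ENNReal.ofReal
        (Real.exp (tailCocycle b ⟨(x, tailTranslate d x), tailRel_tailTranslate d x⟩)) :=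
      ENNReal.measurable_ofReal.comp (Real.measurable_exp.comp ((measurable_tailCocycle b).comp
        (measurable_tailRelGraph_mk (measurable_tailTranslate d) _)))
    rw [hRN γ hγ, map_tailTranslate_symm hb d, restrict_withDensity hS, restrict_withDensity hS,
      withDensity_eq_iff_of_sigmaFinite m1.aemeasurable m2.aemeasurable,
      Filter.EventuallyEq, ae_restrict_iff' hS] at hmaps
    filter_upwards [hmaps] with x hx hxd hxy
    have hx' := (ENNReal.ofReal_eq_ofReal_iff (hpos _).le (Real.exp_nonneg _)).1 (hx hxd)
    rw [hx', Real.log_exp]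
    congr 3
    exact hxd.symm
  filter_upwards [ae_all_iff.2 fun γ => ae_all_iff.2 (key γ)] with x hx y hxy
  obtain ⟨γ, hγ, rfl⟩ := (hΓ x y).1 hxy
  obtain ⟨d, hd⟩ := exists_tailTranslate_eq hxy
  exact hx ⟨γ, hγ⟩ d hd.symm hxy

/-! ### Ergodicity of the skew product -/

/-- For a set invariant under the skew product relation, a translation carries the part of a section
in the cylinder of zeros to the part of another section, shifted by the value of the cocycle, in the
cylinder of `d`; its density is constant there. -/
theorem infinitePi_cylinder_inter_eq {μ : ℕ → Measure (Fin 2)} [∀ i, IsProbabilityMeasure (μ i)]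
    {b : ℕ → ℝ} (hb : ∀ i, μ i {1} = ENNReal.ofReal (Real.exp (b i)) * μ i {0}) (a : ℕ → ℝ)
    {B : Set ((ℕ → Fin 2) × ℝ)} (hB : MeasurableSet B)
    (hinv : ∀ᵐ x ∂Measure.infinitePi μ, ∀ y, ∀ hxy : tailRel (Fin 2) x y, ∀ g,
      (x, g) ∈ B ↔ (y, tailCocycle a ⟨(x, y), hxy⟩ + g) ∈ B)
    (d : ℕ →₀ Fin 2) {n : ℕ} (hd : ∀ i ≥ n, d i = 0) (g : ℝ) :
    Measure.infinitePi μ (PiNat.cylinder d n ∩ (fun x => (x, g)) ⁻¹' B) =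
      ENNReal.ofReal (Real.exp (∑ i ∈ Finset.range n, ((d i : ℕ) : ℝ) * b i)) *
        Measure.infinitePi μ (PiNat.cylinder 0 n ∩
          (fun x => (x, g - ∑ i ∈ Finset.range n, ((d i : ℕ) : ℝ) * a i)) ⁻¹' B) := by
  have hcyl : ∀ c : ℕ → ℝ, ∀ x ∈ PiNat.cylinder (0 : ℕ → Fin 2) n,
      tailCocycle c ⟨(x, tailTranslate d x), tailRel_tailTranslate d x⟩ =
        ∑ i ∈ Finset.range n, ((d i : ℕ) : ℝ) * c i := by
    intro c x hx
    rw [PiNat.mem_cylinder_iff] at hx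
    rw [tailCocycle_eq_sum c _ (n := n)
      (fun i hi => by simp [tailTranslate_apply, hd i hi])]
    refine Finset.sum_congr rfl fun i hi => ?_
    simp [tailTranslate_apply, hx i (Finset.mem_range.1 hi)]
  have hm : ∀ g : ℝ, MeasurableSet ((fun x : ℕ → Fin 2 => (x, g)) ⁻¹' B) :=
    fun g => measurable_prodMk_right hB
  set s := ∑ i ∈ Finset.range n, ((d i : ℕ) : ℝ) * a i with hs
  have md : Measurable (tailTranslate d).symm := by
    rw [tailTranslate_symm]
    exact measurable_tailTranslate _
  have hpre : tailTranslate d ⁻¹' PiNat.cylinder d n = PiNat.cylinder 0 n := by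
    ext x
    simp [PiNat.mem_cylinder_iff, tailTranslate_apply]
  have hmA : MeasurableSet (PiNat.cylinder d n ∩ (fun x : ℕ → Fin 2 => (x, g)) ⁻¹' B) :=
    (measurableSet_cylinder_fin_two _ _).inter (hm g)
  have hmap := Measure.map_apply (μ := Measure.infinitePi μ) md (measurable_tailTranslate d hmA)
  rw [← Set.preimage_comp, Equiv.self_comp_symm, Set.preimage_id] at hmap
  rw [← hmap, map_tailTranslate_symm hb d, withDensity_apply _ (measurable_tailTranslate d hmA)]
  have hae : (tailTranslate d ⁻¹' (PiNat.cylinder d n ∩ (fun x : ℕ → Fin 2 => (x, g)) ⁻¹' B) :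
      Set (ℕ → Fin 2)) =ᵐ[Measure.infinitePi μ]
        (PiNat.cylinder 0 n ∩ (fun x : ℕ → Fin 2 => (x, g - s)) ⁻¹' B : Set (ℕ → Fin 2)) := by
    rw [Set.preimage_inter, hpre, eventuallyEq_set]
    filter_upwards [hinv] with x hx
    refine and_congr_right fun hxc => ?_
    have := hx (tailTranslate d x) (tailRel_tailTranslate d x) (g - s)
    rw [hcyl a x hxc, add_sub_cancel] at this
    exact this.symm
  rw [setLIntegral_congr hae, setLIntegral_congr_fun
    ((measurableSet_cylinder_fin_two _ _).inter (hm _)) (g := fun _ => _), setLIntegral_const]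
  intro x hx
  dsimp only
  rw [hcyl b x hx.1]

/-- A set invariant under the skew product relation meets every cylinder in a fixed proportion,
over almost every point of `ℝ`: the proportions in the cylinders of zeros, as functions on `ℝ`, form
a bounded harmonic sequence. -/
theorem ae_infinitePi_cylinder_inter {μ : ℕ → Measure (Fin 2)} [∀ i, IsProbabilityMeasure (μ i)]
    {b ε : ℕ → ℝ} {c κ : ℝ} (hb : ∀ i, μ i {1} = ENNReal.ofReal (Real.exp (b i)) * μ i {0})
    (hκ : 0 < κ) (hp : ∀ i, κ ≤ (μ i).real {1} * (μ i).real {0})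
    (hε : Tendsto ε atTop (𝓝 0)) (hε2 : ¬ Summable fun i => ε i ^ 2)
    {B : Set ((ℕ → Fin 2) × ℝ)} (hB : MeasurableSet B)
    (hinv : ∀ᵐ x ∂Measure.infinitePi μ, ∀ y, ∀ hxy : tailRel (Fin 2) x y, ∀ g,
      (x, g) ∈ B ↔ (y, tailCocycle (fun i => c + ε i) ⟨(x, y), hxy⟩ + g) ∈ B) :
    ∃ r : ENNReal, ∀ n, ∀ᵐ g : ℝ,
      Measure.infinitePi μ (PiNat.cylinder 0 n ∩ (fun x => (x, g)) ⁻¹' B) =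
        r * Measure.infinitePi μ (PiNat.cylinder 0 n) := by
  set ν := Measure.infinitePi μ with hν
  have hsum : ∀ i, (μ i).real {1} + (μ i).real {0} = 1 := fun i => by
    have h1 : ({1}ᶜ : Set (Fin 2)) = {0} := by
      ext k
      fin_cases k <;> simp
    rw [← h1]
    exact probReal_add_probReal_compl (MeasurableSet.singleton _)
  have hb' : ∀ i, (μ i).real {1} = Real.exp (b i) * (μ i).real {0} := fun i => by
    rw [measureReal_def, hb i, ENNReal.toReal_mul, ENNReal.toReal_ofReal (Real.exp_nonneg _),
      measureReal_def]
  have hq : ∀ i, 0 < (μ i).real {0} := fun i => by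
    refine lt_of_le_of_ne measureReal_nonneg fun h => ?_
    have := hp i
    rw [← h, mul_zero] at this
    linarith
  have hQ : ∀ n, ν.real (PiNat.cylinder 0 n) = ∏ i ∈ Finset.range n, (μ i).real {0} := fun n => by
    rw [PiNat.cylinder_eq_pi, measureReal_def, hν,
      Measure.infinitePi_pi _ fun i _ => MeasurableSet.singleton _, ENNReal.toReal_prod]
    rfl
  have hQpos : ∀ n, 0 < ν.real (PiNat.cylinder 0 n) := fun n => by
    rw [hQ]
    exact Finset.prod_pos fun i _ => hq i
  have hm : ∀ g : ℝ, MeasurableSet ((fun x : ℕ → Fin 2 => (x, g)) ⁻¹' B) :=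
    fun g => measurable_prodMk_right hB
  have hex : ∃ r : ℝ, ∀ n, ∀ᵐ g : ℝ, ν.real (PiNat.cylinder 0 n ∩ (fun x => (x, g)) ⁻¹' B) /
      ν.real (PiNat.cylinder 0 n) = r := by
    refine harmonic_ae_const_forall (p := fun i => (μ i).real {1}) (c := c)
      (u := fun n g => ν.real (PiNat.cylinder 0 n ∩ (fun x => (x, g)) ⁻¹' B) /
        ν.real (PiNat.cylinder 0 n)) (M := 1)
      (fun i => measureReal_nonneg) (fun i => measureReal_le_one) hκ
      (fun i => by
        rw [show 1 - (μ i).real {1} = (μ i).real {0} by linarith [hsum i]]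
        exact hp i) hε hε2 (fun n g => ?_) (fun n => ?_) (fun n g => ?_)
    · -- The cylinder of `n` zeros splits according to the next coordinate.
      have hsplit : PiNat.cylinder (0 : ℕ → Fin 2) n = PiNat.cylinder 0 (n + 1) ∪
          PiNat.cylinder (Finsupp.single n (1 : Fin 2) : ℕ →₀ Fin 2) (n + 1) := by
        ext x
        simp only [Set.mem_union, PiNat.mem_cylinder_iff, Nat.lt_succ_iff_lt_or_eq, Pi.zero_apply]
        constructor
        · intro hx
          rcases (by decide : ∀ k : Fin 2, k = 0 ∨ k = 1) (x n) with h | h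
          · left
            rintro i (hi | rfl)
            exacts [hx i hi, h]
          · right
            rintro i (hi | rfl)
            · rw [hx i hi, Finsupp.single_eq_of_ne hi.ne]
            · rw [h, Finsupp.single_eq_same]
        · rintro (hx | hx) i hi
          · exact hx i (Or.inl hi)
          · rw [hx i (Or.inl hi), Finsupp.single_eq_of_ne hi.ne]
      have hdisj : Disjoint (PiNat.cylinder (0 : ℕ → Fin 2) (n + 1) ∩ (fun x => (x, g)) ⁻¹' B)
          (PiNat.cylinder (Finsupp.single n (1 : Fin 2) : ℕ →₀ Fin 2) (n + 1) ∩
            (fun x => (x, g)) ⁻¹' B) := by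
        refine Set.disjoint_left.2 fun x h1 h2 => ?_
        have e1 := PiNat.mem_cylinder_iff.1 h1.1 n n.lt_succ_self
        have e2 := PiNat.mem_cylinder_iff.1 h2.1 n n.lt_succ_self
        rw [e1, Finsupp.single_eq_same] at e2
        exact zero_ne_one e2
      have hone := infinitePi_cylinder_inter_eq hb (fun i => c + ε i) hB hinv
        (Finsupp.single n 1) (n := n + 1) (fun i hi => Finsupp.single_eq_of_ne (by omega)) g
      have hterm : ∀ e : ℕ → ℝ, ∑ i ∈ Finset.range (n + 1),
          (((Finsupp.single n (1 : Fin 2) i : Fin 2) : ℕ) : ℝ) * e i = e n := fun e => by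
        rw [Finset.sum_range_succ, Finset.sum_eq_zero fun i hi => ?_, Finsupp.single_eq_same]
        · simp
        · rw [Finsupp.single_eq_of_ne (Finset.mem_range.1 hi).ne]
          simp
      rw [hterm, hterm, ← hν] at hone
      have hone' := congrArg ENNReal.toReal hone
      rw [ENNReal.toReal_mul, ENNReal.toReal_ofReal (Real.exp_nonneg _), ← measureReal_def,
        ← measureReal_def] at hone'
      simp only [stepAverage]
      rw [hsplit, Set.union_inter_distrib_right, ← hsplit,
        measureReal_union hdisj ((measurableSet_cylinder_fin_two _ _).inter (hm g)), hone',
        show 1 - (μ n).real {1} = (μ n).real {0} by linarith [hsum n], hb' n]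
      have hQn : ν.real (PiNat.cylinder 0 (n + 1)) =
          ν.real (PiNat.cylinder 0 n) * (μ n).real {0} := by
        rw [hQ, hQ, Finset.prod_range_succ]
      rw [hQn]
      have := (hQpos n).ne'
      have := (hq n).ne'
      field_simp
    · refine Measurable.div_const ?_ _
      refine Measurable.ennreal_toReal ?_
      have hcut : (fun g : ℝ => ν (PiNat.cylinder 0 n ∩ (fun x => (x, g)) ⁻¹' B)) = fun g =>
          ν ((fun x => (x, g)) ⁻¹' (PiNat.cylinder (0 : ℕ → Fin 2) n ×ˢ Set.univ ∩ B)) := by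
        ext g
        congr 1
        ext x
        simp
      rw [hcut]
      exact measurable_measure_prodMk_right
        (((measurableSet_cylinder_fin_two 0 n).prod MeasurableSet.univ).inter hB)
    · rw [abs_of_nonneg (div_nonneg measureReal_nonneg measureReal_nonneg),
        div_le_one (hQpos n)]
      exact measureReal_mono Set.inter_subset_left
  obtain ⟨r, hr⟩ := hex
  have hr0 : 0 ≤ r := by
    obtain ⟨g, hg⟩ := (hr 0).exists
    rw [← hg]
    exact div_nonneg measureReal_nonneg measureReal_nonneg
  refine ⟨ENNReal.ofReal r, fun n => ?_⟩
  filter_upwards [hr n] with g hg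
  rw [div_eq_iff (hQpos n).ne'] at hg
  rw [← ofReal_measureReal, hg, ENNReal.ofReal_mul hr0, ofReal_measureReal]

/-- Almost every section of an invariant set is null, or almost every section is conull, because `μ`
restricted to a section is a fixed multiple of `μ`. -/
theorem isErgodic_of_ae_invariant {μ : ℕ → Measure (Fin 2)} [∀ i, IsProbabilityMeasure (μ i)]
    {b ε : ℕ → ℝ} {c κ : ℝ} (hb : ∀ i, μ i {1} = ENNReal.ofReal (Real.exp (b i)) * μ i {0})
    (hκ : 0 < κ) (hp : ∀ i, κ ≤ (μ i).real {1} * (μ i).real {0})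
    (hε : Tendsto ε atTop (𝓝 0)) (hε2 : ¬ Summable fun i => ε i ^ 2)
    {B : Set ((ℕ → Fin 2) × ℝ)} (hB : MeasurableSet B)
    (hinv : ∀ᵐ x ∂Measure.infinitePi μ, ∀ y, ∀ hxy : tailRel (Fin 2) x y, ∀ g,
      (x, g) ∈ B ↔ (y, tailCocycle (fun i => c + ε i) ⟨(x, y), hxy⟩ + g) ∈ B) :
    (Measure.infinitePi μ).prod volume B = 0 ∨ (Measure.infinitePi μ).prod volume Bᶜ = 0 := by
  obtain ⟨r, hr⟩ := ae_infinitePi_cylinder_inter hb hκ hp hε hε2 hB hinv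
  have hcyl : ∀ᵐ g : ℝ, ∀ (n : ℕ) (d : ℕ →₀ Fin 2), (∀ i ≥ n, d i = 0) →
      Measure.infinitePi μ (PiNat.cylinder d n ∩ (fun x => (x, g)) ⁻¹' B) =
        r * Measure.infinitePi μ (PiNat.cylinder d n) := by
    refine ae_all_iff.2 fun n => ae_all_iff.2 fun d => ?_
    by_cases hd : ∀ i ≥ n, d i = 0
    · have hsub := (measurePreserving_sub_right (volume : Measure ℝ)
        (∑ i ∈ Finset.range n, ((d i : ℕ) : ℝ) * (c + ε i))).quasiMeasurePreserving.ae (hr n)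
      filter_upwards [hsub] with g hg _
      rw [infinitePi_cylinder_inter_eq hb _ hB hinv d hd g, hg,
        infinitePi_cylinder_eq_exp_mul hb 0 d n]
      simp only [Pi.zero_apply, Fin.val_zero, Nat.cast_zero, sub_zero]
      ring
    · exact Eventually.of_forall fun g h => absurd h hd
  have hmeas : ∀ᵐ g : ℝ, (Measure.infinitePi μ).restrict ((fun x => (x, g)) ⁻¹' B) =
      r • Measure.infinitePi μ := by
    filter_upwards [hcyl] with g hg
    refine (measure_ext_of_cylinder 0 fun n _ w => ?_).symm
    let d : ℕ →₀ Fin 2 := Finsupp.onFinset (Finset.range n) (fun i => if i < n then w i else 0)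
      fun i hi => by
        by_contra h
        rw [Finset.mem_range] at h
        simp [h] at hi
    have hd : ∀ i ≥ n, d i = 0 := fun i hi => if_neg (not_lt.2 hi)
    have hw : PiNat.cylinder w n = PiNat.cylinder d n := by
      refine (PiNat.mem_cylinder_iff_eq.1 (PiNat.mem_cylinder_iff.2 fun i hi => ?_))
      exact (if_pos hi).symm
    rw [hw, Measure.restrict_apply (measurableSet_cylinder_fin_two _ _), hg n d hd]
    rfl
  by_cases hr0 : r = 0
  · left
    rw [Measure.prod_apply_symm hB, lintegral_eq_zero_iff (measurable_measure_prodMk_right hB)]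
    filter_upwards [hmeas] with g hg
    rw [hr0, zero_smul, Measure.restrict_eq_zero] at hg
    exact hg
  · right
    rw [Measure.prod_apply_symm hB.compl,
      lintegral_eq_zero_iff (measurable_measure_prodMk_right hB.compl)]
    filter_upwards [hmeas] with g hg
    have h := congrArg (fun m => m ((fun x : ℕ → Fin 2 => (x, g)) ⁻¹' Bᶜ)) hg
    rw [Measure.restrict_apply (measurable_prodMk_right hB.compl), ← Set.preimage_inter,
      Set.compl_inter_self, Set.preimage_empty, measure_empty, Measure.smul_apply, smul_eq_mul,
      eq_comm, mul_eq_zero] at h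
    exact h.resolve_left hr0

/-- The weights of the two symbols are bounded away from zero. -/
theorem exists_pos_le_mul_div_sq {lam : ℝ} (hlam : 0 < lam) {ε : ℕ → ℝ}
    (hε : Tendsto ε atTop (𝓝 0)) :
    ∃ κ > 0, ∀ i, κ ≤ lam * Real.exp (ε i) / (1 + lam * Real.exp (ε i)) *
      (1 / (1 + lam * Real.exp (ε i))) := by
  obtain ⟨K, hK⟩ := (Metric.isBounded_range_of_tendsto ε hε).exists_norm_le
  refine ⟨lam * Real.exp (-K) / (1 + lam * Real.exp K) * (1 / (1 + lam * Real.exp K)),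
    by positivity, fun i => ?_⟩
  have hi := abs_le.1 (hK (ε i) ⟨i, rfl⟩)
  have h1 : Real.exp (-K) ≤ Real.exp (ε i) := Real.exp_le_exp.2 hi.1
  have h2 : Real.exp (ε i) ≤ Real.exp K := Real.exp_le_exp.2 hi.2
  gcongr

/-! ### Logarithms of Radon-Nikodym cocycles -/

theorem isErgodicCocycle_log_sub_mul_tailLambda {μ : ℕ → Measure (Fin 2)}
    [∀ i, IsProbabilityMeasure (μ i)] {lam κ : ℝ} {ε : ℕ → ℝ}
    (hb : ∀ i, μ i {1} = ENNReal.ofReal (Real.exp (Real.log lam + ε i)) * μ i {0})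
    (hκ : 0 < κ) (hp : ∀ i, κ ≤ (μ i).real {1} * (μ i).real {0})
    (hε : Tendsto ε atTop (𝓝 0)) (hε2 : ¬ Summable fun i => ε i ^ 2)
    {Δ : RelGraph (tailRel (Fin 2)) → ℝ}
    (h : IsRadonNikodymCocycle (tailRel (Fin 2)) (Measure.infinitePi μ) Δ) (t : ℝ) :
    IsErgodicCocycle (tailRel (Fin 2)) (Measure.infinitePi μ) (volume : Measure ℝ)
      (fun p => Real.log (Δ p) - t * tailLambda lam p) := by
  have hae : ∀ᵐ x ∂Measure.infinitePi μ, ∀ y, ∀ hxy : tailRel (Fin 2) x y,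
      Real.log (Δ ⟨(x, y), hxy⟩) - t * tailLambda lam ⟨(x, y), hxy⟩ =
        tailCocycle (fun i => (Real.log lam - t * Real.log lam) + ε i) ⟨(x, y), hxy⟩ := by
    filter_upwards [ae_log_eq_tailCocycle hb h] with x hx y hxy
    rw [hx y hxy, tailCocycle_sub_mul_tailLambda]
    simp only [add_sub_right_comm]
  refine ⟨⟨?_, _, hae, fun x hx y hy z _ hxy hyz => ?_⟩, fun B hB hinv => ?_⟩
  · exact (Real.measurable_log.comp h.1).sub ((measurable_tailCocycle _).const_mul t)
  · dsimp only
    rw [hx y hxy, hy z hyz, hx z ((tailRel (Fin 2)).trans hxy hyz), tailCocycle_add]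
  · refine isErgodic_of_ae_invariant hb hκ hp hε hε2 hB
      (c := Real.log lam - t * Real.log lam) ?_
    filter_upwards [hae] with x hx y hxy g
    rw [← hx y hxy]
    exact hinv (x, g) (y, _) ⟨hxy, rfl⟩

theorem proposition1p5 (lam : ℝ) (hlam0 : 0 < lam) (hlam1 : lam ≤ 1)
    (ε : ℕ → ℝ) (hε : Tendsto ε atTop (𝓝 0)) (hε2 : ¬ Summable (fun i => ε i ^ 2))
    (μ : ℕ → Measure (Fin 2)) [∀ i, IsProbabilityMeasure (μ i)]
    (hμ0 : ∀ i, μ i {0} = ENNReal.ofReal (1 / (1 + lam * Real.exp (ε i))))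
    (hμ1 : ∀ i, μ i {1} =
      ENNReal.ofReal (lam * Real.exp (ε i) / (1 + lam * Real.exp (ε i)))) :
    (∃ Δ : RelGraph (tailRel (Fin 2)) → ℝ,
      IsRadonNikodymCocycle (tailRel (Fin 2)) (Measure.infinitePi μ) Δ) ∧
    ∀ Δ : RelGraph (tailRel (Fin 2)) → ℝ,
      IsRadonNikodymCocycle (tailRel (Fin 2)) (Measure.infinitePi μ) Δ →
        IsErgodicCocycle (tailRel (Fin 2)) (Measure.infinitePi μ) (volume : Measure ℝ)
          (fun p => Real.log (Δ p) - tailLambda lam p) ∧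
        ∀ t : ℝ,
          IsErgodicCocycle (tailRel (Fin 2)) (Measure.infinitePi μ) (volume : Measure ℝ)
            (fun p => Real.log (Δ p) - t * tailLambda lam p) := by
  have hexp : ∀ i, Real.exp (Real.log lam + ε i) = lam * Real.exp (ε i) := fun i => by
    rw [Real.exp_add, Real.exp_log hlam0]
  have hb : ∀ i, μ i {1} = ENNReal.ofReal (Real.exp (Real.log lam + ε i)) * μ i {0} := fun i => by
    rw [hμ1, hμ0, ← ENNReal.ofReal_mul (Real.exp_nonneg _), hexp, mul_one_div]
  obtain ⟨κ, hκ, hle⟩ := exists_pos_le_mul_div_sq hlam0 hε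
  have hp : ∀ i, κ ≤ (μ i).real {1} * (μ i).real {0} := fun i => by
    rw [measureReal_def, measureReal_def, hμ1, hμ0, ENNReal.toReal_ofReal (by positivity),
      ENNReal.toReal_ofReal (by positivity)]
    exact hle i
  refine ⟨⟨_, isRadonNikodymCocycle_exp_tailCocycle hb⟩, fun Δ hΔ => ⟨?_, fun t =>
    isErgodicCocycle_log_sub_mul_tailLambda hb hκ hp hε hε2 hΔ t⟩⟩
  have := isErgodicCocycle_log_sub_mul_tailLambda hb hκ hp hε hε2 hΔ 1
  simpa only [one_mul] using this
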